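/- Let $\mathcal Y$ be a finite set, $\phi:\mathcal Y\to\mathbb R^d$, and for $\theta\in\mathbb R^d$ let $p_\theta(y)=\exp\{\phi(y)^\top\theta-A(\theta)\}$ with $A(\theta)=\log\sum_{y\in\mathcal Y}\exp\{\phi(y)^\top\theta\}$. Let $\theta^*\in\mathbb R^d$ be such that the Fisher information $\mathcal I=\operatorname{Cov}[\phi(y)]$, $y\sim p_{\theta^*}$, is invertible, let $u$ be a probability distribution on $\mathcal Y$, and let $0<\epsilon\le 1$. Let $(y^{(i)},o^{(i)})_{i\ge1}$ be i.i.d. with $y^{(i)}\sim p_{\theta^*}$ and, conditionally on $y^{(i)}=y$, $o^{(i)}$ drawn from the classical randomized response distribution $S(o\mid y)=\epsilon\,\mathbf 1[o=y]+(1-\epsilon)u(o)$. Put $$\beta(o)=\frac{\phi(o)-(1-\epsilon)\,\mathbb E_{y'\sim u}[\phi(y')]}{\epsilon},\qquad \hat\mu_n=\frac1n\sum_{i=1}^n\beta(o^{(i)}),$$ and let the moments-based estimator $\hat\theta_n$ be a function of $(o^{(1)},\dots,o^{(n)})$ that is a maximizer of $\theta\mapsto\hat\mu_n^\top\theta-A(\theta)$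 over $\mathbb R^d$ whenever a maximizer exists (and is arbitrary otherwise). Then, with probability tending to $1$ as $n\to\infty$, a maximizer exists and is unique, and $$\sqrt n\,(\hat\theta_n-\theta^*)\ \xrightarrow{d}\ \mathcal N(0,V),\qquad V=\mathcal I^{-1}+\mathcal I^{-1}H\,\mathcal I^{-1},$$ where $V$ is positive semidefinite and, with $y\sim p_{\theta^*}$, $y'\sim u$ and $v^{\otimes2}=vv^\top$, $$H=\frac{1-\epsilon}{\epsilon^2}\operatorname{Cov}[\phi(y')]+\frac{1-\epsilon}{\epsilon}\,\mathbb E\big[(\phi(y)-\mathbb E[\phi(y')])^{\otimes2}\big].$$ -/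

import Mathlib

open Filter Topology MeasureTheory ProbabilityTheory

namespace RandResponse

noncomputable section

variable {Y : Type*} [Fintype Y] {d : ℕ}

/-- The log-partition function `A(θ) = log ∑_y exp(φ(y)ᵀ θ)`. -/
def logPartition (φ : Y → EuclideanSpace ℝ (Fin d)) (θ : EuclideanSpace ℝ (Fin d)) : ℝ :=
  Real.log (∑ y, Real.exp (inner ℝ (φ y) θ))

/-- The exponential family `p_θ(y) = exp(φ(y)ᵀ θ - A(θ))`. -/
def expFamily (φ : Y → EuclideanSpace ℝ (Fin d)) (θ : EuclideanSpace ℝ (Fin d)) (y : Y) : ℝ :=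
  Real.exp (inner ℝ (φ y) θ - logPartition φ θ)

/-- The matrix `v^{⊗2} = v vᵀ`. -/
def outerSq (v : EuclideanSpace ℝ (Fin d)) : Matrix (Fin d) (Fin d) ℝ :=
  Matrix.of fun i j => v i * v j

/-- The expectation `E[f(y)]`, where `y` has probability mass function `p`. -/
def mean (p : Y → ℝ) (f : Y → EuclideanSpace ℝ (Fin d)) : EuclideanSpace ℝ (Fin d) :=
  ∑ y, p y • f y

/-- The covariance matrix `Cov[f(y)] = E[(f(y) - E f(y))^{⊗2}]`, where `y` has probability mass
function `p`. -/
def covMat (p : Y → ℝ) (f : Y → EuclideanSpace ℝ (Fin d)) : Matrix (Fin d) (Fin d) ℝ :=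
  ∑ y, p y • outerSq (f y - mean p f)

/-- The Fisher information matrix `Cov[φ(y)]`, `y ∼ p_θ`. -/
def fisherInfo (φ : Y → EuclideanSpace ℝ (Fin d)) (θ : EuclideanSpace ℝ (Fin d)) :
    Matrix (Fin d) (Fin d) ℝ :=
  covMat (expFamily φ θ) φ

/-- The classical randomized response supervision distribution
`S(o ∣ y) = ε 1[o = y] + (1 - ε) u(o)`. -/
def supervision [DecidableEq Y] (ε : ℝ) (u : Y → ℝ) (o y : Y) : ℝ :=
  ε * (if o = y then 1 else 0) + (1 - ε) * u o

/-- The observation function `β(o) = (φ(o) - (1 - ε) E[φ(y')]) / ε`, `y' ∼ u`. -/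
def obsFun (φ : Y → EuclideanSpace ℝ (Fin d)) (ε : ℝ) (u : Y → ℝ) (o : Y) :
    EuclideanSpace ℝ (Fin d) :=
  ε⁻¹ • (φ o - (1 - ε) • mean u φ)

/-- The estimated sufficient statistics: the average of `β` over the observed sample. -/
def muHat (φ : Y → EuclideanSpace ℝ (Fin d)) (ε : ℝ) (u : Y → ℝ) {n : ℕ} (o : Fin n → Y) :
    EuclideanSpace ℝ (Fin d) :=
  (n : ℝ)⁻¹ • ∑ i, obsFun φ ε u (o i)

/-- `θ` maximizes the moment objective `θ ↦ μᵀ θ - A(θ)` over the whole parameter space. -/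
def IsMomentMaximizer (φ : Y → EuclideanSpace ℝ (Fin d)) (μ θ : EuclideanSpace ℝ (Fin d)) : Prop :=
  ∀ θ' : EuclideanSpace ℝ (Fin d), inner ℝ μ θ' - logPartition φ θ' ≤ inner ℝ μ θ - logPartition φ θ

/-- `T` is a moments-based estimator from `n` observations: its value at a sample maximizes
`θ ↦ μ̂ᵀ θ - A(θ)` whenever there is a maximizer. (If the objective has no maximizer, which is
possible as `μ̂` need not be an attainable mean of `φ`, the value of `T` is unrestricted.) -/
def IsMomentEstimator (φ : Y → EuclideanSpace ℝ (Fin d)) (ε : ℝ) (u : Y → ℝ) (n : ℕ)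
    (T : (Fin n → Y) → EuclideanSpace ℝ (Fin d)) : Prop :=
  ∀ o : Fin n → Y, (∃ θ, IsMomentMaximizer φ (muHat φ ε u o) θ) →
    IsMomentMaximizer φ (muHat φ ε u o) (T o)

/-- The matrix `H = (1-ε)/ε² Cov[φ(y')] + (1-ε)/ε E[(φ(y) - E φ(y'))^{⊗2}]`, where `y ∼ p_θ` and
`y' ∼ u`. -/
def lossMat (φ : Y → EuclideanSpace ℝ (Fin d)) (ε : ℝ) (u : Y → ℝ)
    (θ : EuclideanSpace ℝ (Fin d)) : Matrix (Fin d) (Fin d) ℝ :=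
  ((1 - ε) / ε ^ 2) • covMat u φ +
    ((1 - ε) / ε) • ∑ y, expFamily φ θ y • outerSq (φ y - mean u φ)

/-- The matrix `I⁻¹ + I⁻¹ H I⁻¹`. -/
def asympVar (φ : Y → EuclideanSpace ℝ (Fin d)) (ε : ℝ) (u : Y → ℝ)
    (θ : EuclideanSpace ℝ (Fin d)) : Matrix (Fin d) (Fin d) ℝ :=
  (fisherInfo φ θ)⁻¹ + (fisherInfo φ θ)⁻¹ * lossMat φ ε u θ * (fisherInfo φ θ)⁻¹

end

end RandResponse

/-! The objective `μᵀθ - A(θ)` is governed by the mean map `m(θ) = E_θ[φ(y)]`: a solution of `m(θ) =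
μ` is a global maximizer. Indeed, with the centred variable `X = ⟪φ y - m(θ), θ' - θ⟫`, the Bregman
divergence `D` of `A` from `θ` to `θ'` satisfies `exp D - 1 = E_θ[exp X - 1 - X] ≥ 0`. Equality
forces `X = 0` for every `y`, which invertible Fisher information excludes unless `θ' = θ`.

The derivative of `m` at `θ*` is the Fisher information `I`, so the inverse function theorem gives a
local inverse `g` near `μ₀ = m(θ*)`, with derivative `I⁻¹` at `μ₀`. An observation follows the
mixture `ε p_θ* + (1 - ε) u`, and `β` is the affine correction making `E[β(o)] = μ₀`. By the strong
law `μ̂_n → μ₀` almost surely, so eventually `g(μ̂_n)` is the unique maximizer and the estimator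
equals it.

The delta method (`tendstoInDistribution_of_eventually_eq_comp`) and the central limit theorem then
give a Gaussian limit with covariance `I⁻¹ Cov[β(o)] I⁻¹`. Since `Cov[β(o)] = I + H`
(`covMat_obsFun`), this is `V`. -/

namespace RandResponse

/-! ### Exponential families: convex duality and the mean map -/

section ExponentialFamily

variable {Y : Type*} [Fintype Y] {d : ℕ}

lemma sum_exp_inner_pos [Nonempty Y] (φ : Y → EuclideanSpace ℝ (Fin d))
    (θ : EuclideanSpace ℝ (Fin d)) : 0 < ∑ y, Real.exp (inner ℝ (φ y) θ) :=
  Finset.sum_pos (fun _ _ => Real.exp_pos _) Finset.univ_nonempty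

lemma expFamily_pos (φ : Y → EuclideanSpace ℝ (Fin d)) (θ : EuclideanSpace ℝ (Fin d)) (y : Y) :
    0 < expFamily φ θ y :=
  Real.exp_pos _

lemma expFamily_eq_div [Nonempty Y] (φ : Y → EuclideanSpace ℝ (Fin d))
    (θ : EuclideanSpace ℝ (Fin d)) (y : Y) :
    expFamily φ θ y = Real.exp (inner ℝ (φ y) θ) / ∑ y', Real.exp (inner ℝ (φ y') θ) := by
  rw [expFamily, logPartition, Real.exp_sub, Real.exp_log (sum_exp_inner_pos φ θ)]

lemma sum_expFamily [Nonempty Y] (φ : Y → EuclideanSpace ℝ (Fin d))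
    (θ : EuclideanSpace ℝ (Fin d)) : ∑ y, expFamily φ θ y = 1 := by
  simp_rw [expFamily_eq_div, ← Finset.sum_div]
  exact div_self (sum_exp_inner_pos φ θ).ne'

lemma inner_mean (p : Y → ℝ) (f : Y → EuclideanSpace ℝ (Fin d)) (t : EuclideanSpace ℝ (Fin d)) :
    inner ℝ (mean p f) t = ∑ y, p y * inner ℝ (f y) t := by
  simp [mean, sum_inner, real_inner_smul_left]

lemma sum_mul_inner_sub_mean {p : Y → ℝ} (hp : ∑ y, p y = 1)
    (f : Y → EuclideanSpace ℝ (Fin d)) (t : EuclideanSpace ℝ (Fin d)) :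
    ∑ y, p y * inner ℝ (f y - mean p f) t = 0 := by
  simp_rw [inner_sub_left, mul_sub, Finset.sum_sub_distrib, ← Finset.sum_mul, hp, inner_mean,
    one_mul, sub_self]

lemma outerSq_mulVec (v w : EuclideanSpace ℝ (Fin d)) :
    (outerSq v).mulVec w = (inner ℝ v w : ℝ) • (v : Fin d → ℝ) := by
  ext i
  simp only [outerSq, Matrix.mulVec, dotProduct, Matrix.of_apply, PiLp.inner_apply, Pi.smul_apply,
    smul_eq_mul, Finset.sum_mul]
  refine Finset.sum_congr rfl fun j _ => ?_
  simp
  ring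

lemma dotProduct_outerSq (v w : EuclideanSpace ℝ (Fin d)) :
    (w : Fin d → ℝ) ⬝ᵥ (outerSq v).mulVec w = (inner ℝ v w : ℝ) ^ 2 := by
  rw [outerSq_mulVec, dotProduct_smul, smul_eq_mul, sq]
  congr 1

lemma dotProduct_sum_smul_outerSq (p : Y → ℝ) (f : Y → EuclideanSpace ℝ (Fin d))
    (w : EuclideanSpace ℝ (Fin d)) :
    (w : Fin d → ℝ) ⬝ᵥ (∑ y, p y • outerSq (f y)).mulVec w =
      ∑ y, p y * (inner ℝ (f y) w : ℝ) ^ 2 := by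
  simp [Matrix.sum_mulVec, dotProduct_sum, Matrix.smul_mulVec, dotProduct_smul,
    dotProduct_outerSq]

lemma posSemidef_sum_smul_outerSq {p : Y → ℝ} (hp : ∀ y, 0 ≤ p y)
    (f : Y → EuclideanSpace ℝ (Fin d)) : (∑ y, p y • outerSq (f y)).PosSemidef := by
  refine Matrix.posSemidef_sum _ fun y _ => Matrix.PosSemidef.smul ?_ (hp y)
  exact Matrix.posSemidef_vecMulVec_self_star (f y : Fin d → ℝ)

lemma eq_zero_of_inner_sub_mean_eq_zero {φ : Y → EuclideanSpace ℝ (Fin d)}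
    {θ : EuclideanSpace ℝ (Fin d)} (hI : IsUnit (fisherInfo φ θ).det)
    {h : EuclideanSpace ℝ (Fin d)}
    (hh : ∀ y, inner ℝ (φ y - mean (expFamily φ θ) φ) h = 0) : h = 0 := by
  have h0 : (fisherInfo φ θ).mulVec h = 0 := by
    simp [fisherInfo, covMat, Matrix.sum_mulVec, Matrix.smul_mulVec, outerSq_mulVec, hh]
  have := Matrix.eq_zero_of_mulVec_eq_zero hI.ne_zero h0
  ext i
  exact congrFun this i

/-- If `⟪φ y, h⟫` does not depend on `y`, then `h = 0`, as soon as one Fisher information matrix is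
invertible. -/
lemma eq_zero_of_inner_eq_const [Nonempty Y] {φ : Y → EuclideanSpace ℝ (Fin d)}
    {θ : EuclideanSpace ℝ (Fin d)} (hI : IsUnit (fisherInfo φ θ).det)
    {h : EuclideanSpace ℝ (Fin d)} {c : ℝ} (hh : ∀ y, inner ℝ (φ y) h = c) : h = 0 := by
  refine eq_zero_of_inner_sub_mean_eq_zero hI fun y => ?_
  rw [inner_sub_left, inner_mean, hh]
  simp [hh, ← Finset.sum_mul, sum_expFamily]

lemma exp_logPartition_sub [Nonempty Y] (φ : Y → EuclideanSpace ℝ (Fin d))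
    (θ θ' : EuclideanSpace ℝ (Fin d)) :
    Real.exp (logPartition φ θ' - logPartition φ θ) =
      ∑ y, expFamily φ θ y * Real.exp (inner ℝ (φ y) (θ' - θ)) := by
  rw [Real.exp_sub, logPartition, logPartition, Real.exp_log (sum_exp_inner_pos φ θ'),
    Real.exp_log (sum_exp_inner_pos φ θ), Finset.sum_div]
  refine Finset.sum_congr rfl fun y _ => ?_
  rw [expFamily_eq_div, inner_sub_right, Real.exp_sub]
  field_simp

/-- The deviation of `log E exp X` from `E X`, for `X = ⟪φ y, θ' - θ⟫`. -/
lemma exp_logPartition_sub_sub_inner [Nonempty Y] (φ : Y → EuclideanSpace ℝ (Fin d))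
    (θ θ' : EuclideanSpace ℝ (Fin d)) :
    Real.exp (logPartition φ θ' - logPartition φ θ -
        inner ℝ (mean (expFamily φ θ) φ) (θ' - θ)) - 1 =
      ∑ y, expFamily φ θ y * (Real.exp (inner ℝ (φ y - mean (expFamily φ θ) φ) (θ' - θ)) -
        (inner ℝ (φ y - mean (expFamily φ θ) φ) (θ' - θ) + 1)) := by
  simp_rw [mul_sub, mul_add, Finset.sum_sub_distrib, Finset.sum_add_distrib,
    sum_mul_inner_sub_mean (sum_expFamily φ θ), mul_one, sum_expFamily, zero_add]
  congr 1
  rw [Real.exp_sub, exp_logPartition_sub, Finset.sum_div]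
  refine Finset.sum_congr rfl fun y _ => ?_
  rw [inner_sub_left, Real.exp_sub, mul_div_assoc]

/-- The inequality `1 + x ≤ exp x`, applied to each `y`, makes the divergence nonnegative; no
convexity theory of `A` is needed. -/
lemma isMomentMaximizer_of_mean_eq [Nonempty Y] {φ : Y → EuclideanSpace ℝ (Fin d)}
    {μ θ : EuclideanSpace ℝ (Fin d)} (h : mean (expFamily φ θ) φ = μ) :
    IsMomentMaximizer φ μ θ := by
  intro θ'
  have h0 := exp_logPartition_sub_sub_inner φ θ θ'
  have h1 : 0 ≤ ∑ y, expFamily φ θ y *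
      (Real.exp (inner ℝ (φ y - mean (expFamily φ θ) φ) (θ' - θ)) -
        (inner ℝ (φ y - mean (expFamily φ θ) φ) (θ' - θ) + 1)) :=
    Finset.sum_nonneg fun y _ => mul_nonneg (expFamily_pos φ θ y).le
      (sub_nonneg.2 (Real.add_one_le_exp _))
  rw [← h0, sub_nonneg, Real.one_le_exp_iff, h, inner_sub_right] at h1
  linarith

/-- Strictness of `1 + x < exp x` for `x ≠ 0` forces `⟪φ y, θ' - θ⟫` to be constant in `y`. This
condition does not involve the weights `p_θ`, so invertibility at one reference point `θ₀` suffices.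
-/
lemma eq_of_isMomentMaximizer [Nonempty Y] {φ : Y → EuclideanSpace ℝ (Fin d)}
    {θ₀ μ θ θ' : EuclideanSpace ℝ (Fin d)} (hI : IsUnit (fisherInfo φ θ₀).det)
    (h : mean (expFamily φ θ) φ = μ) (h' : IsMomentMaximizer φ μ θ') : θ' = θ := by
  have h1 : Real.exp (logPartition φ θ' - logPartition φ θ -
        inner ℝ (mean (expFamily φ θ) φ) (θ' - θ)) - 1 ≤ 0 := by
    rw [sub_nonpos, Real.exp_le_one_iff, h, inner_sub_right]
    linarith [h' θ]
  rw [exp_logPartition_sub_sub_inner] at h1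
  have hnn : ∀ y ∈ Finset.univ, 0 ≤ expFamily φ θ y *
      (Real.exp (inner ℝ (φ y - mean (expFamily φ θ) φ) (θ' - θ)) -
        (inner ℝ (φ y - mean (expFamily φ θ) φ) (θ' - θ) + 1)) :=
    fun y _ => mul_nonneg (expFamily_pos φ θ y).le (sub_nonneg.2 (Real.add_one_le_exp _))
  have h2 := (Finset.sum_eq_zero_iff_of_nonneg hnn).1 (le_antisymm h1 (Finset.sum_nonneg hnn))
  refine sub_eq_zero.1 (eq_zero_of_inner_eq_const hI
    (c := inner ℝ (mean (expFamily φ θ) φ) (θ' - θ)) fun y => ?_)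
  rw [← sub_eq_zero, ← inner_sub_left]
  by_contra hne
  have := (mul_eq_zero.1 (h2 y (Finset.mem_univ y))).resolve_left (expFamily_pos φ θ y).ne'
  exact (Real.add_one_lt_exp hne).ne' (sub_eq_zero.1 this)

lemma hasStrictFDerivAt_logPartition [Nonempty Y] (φ : Y → EuclideanSpace ℝ (Fin d))
    (θ : EuclideanSpace ℝ (Fin d)) :
    HasStrictFDerivAt (logPartition φ) (innerSL ℝ (mean (expFamily φ θ) φ)) θ := by
  have h : HasStrictFDerivAt (fun θ => ∑ y, Real.exp (inner ℝ (φ y) θ))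
      (∑ y, Real.exp (inner ℝ (φ y) θ) • innerSL ℝ (φ y)) θ :=
    HasStrictFDerivAt.fun_sum fun y _ => (innerSL ℝ (φ y)).hasStrictFDerivAt.exp
  refine (h.log (sum_exp_inner_pos φ θ).ne').congr_fderiv ?_
  refine ContinuousLinearMap.ext fun w => ?_
  simp only [innerSL_apply_apply, inner_mean, smul_apply, sum_apply, smul_eq_mul, Finset.mul_sum]
  refine Finset.sum_congr rfl fun y _ => ?_
  rw [expFamily_eq_div]
  ring

lemma hasStrictFDerivAt_expFamily [Nonempty Y] (φ : Y → EuclideanSpace ℝ (Fin d))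
    (θ : EuclideanSpace ℝ (Fin d)) (y : Y) :
    HasStrictFDerivAt (fun θ => expFamily φ θ y)
      (expFamily φ θ y • innerSL ℝ (φ y - mean (expFamily φ θ) φ)) θ := by
  rw [map_sub]
  exact ((innerSL ℝ (φ y)).hasStrictFDerivAt.sub (hasStrictFDerivAt_logPartition φ θ)).exp

/-- The derivative of the mean map `θ ↦ E_θ[φ(y)]` is the Fisher information matrix. -/
lemma hasStrictFDerivAt_mean_expFamily [Nonempty Y] (φ : Y → EuclideanSpace ℝ (Fin d))
    (θ : EuclideanSpace ℝ (Fin d)) :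
    HasStrictFDerivAt (fun θ => mean (expFamily φ θ) φ)
      (Matrix.toEuclideanCLM (𝕜 := ℝ) (fisherInfo φ θ)) θ := by
  have h : HasStrictFDerivAt (fun θ => mean (expFamily φ θ) φ)
      (∑ y, (expFamily φ θ y • innerSL ℝ (φ y - mean (expFamily φ θ) φ)).smulRight (φ y)) θ :=
    HasStrictFDerivAt.fun_sum fun y _ => (hasStrictFDerivAt_expFamily φ θ y).smul_const (φ y)
  refine h.congr_fderiv (ContinuousLinearMap.ext fun w => ?_)
  ext i
  have h1 : (Matrix.toEuclideanCLM (𝕜 := ℝ) (fisherInfo φ θ) w) i =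
      ∑ y, expFamily φ θ y * (inner ℝ (φ y - mean (expFamily φ θ) φ) w *
        (φ y i - mean (expFamily φ θ) φ i)) := by
    rw [Matrix.ofLp_toEuclideanCLM]
    simp [fisherInfo, covMat, Matrix.sum_mulVec, Matrix.smul_mulVec, outerSq_mulVec]
  rw [h1]
  -- The first factor is already centred, so subtracting the mean from `φ y i` changes nothing.
  simp_rw [mul_sub, ← mul_assoc, Finset.sum_sub_distrib, ← Finset.sum_mul,
    sum_mul_inner_sub_mean (sum_expFamily φ θ), zero_mul, sub_zero]
  simp [inner_sub_left]

/-- An invertible matrix as a continuous linear automorphism of Euclidean space. -/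
noncomputable def matrixCLE (M : Matrix (Fin d) (Fin d) ℝ) (hM : IsUnit M.det) :
    EuclideanSpace ℝ (Fin d) ≃L[ℝ] EuclideanSpace ℝ (Fin d) :=
  ContinuousLinearEquiv.equivOfInverse (Matrix.toEuclideanCLM (𝕜 := ℝ) M)
    (Matrix.toEuclideanCLM (𝕜 := ℝ) M⁻¹)
    (fun x => by
      rw [← mul_apply_eq_comp, ← map_mul, Matrix.nonsing_inv_mul _ hM, map_one,
        one_apply_eq_self])
    (fun x => by
      rw [← mul_apply_eq_comp, ← map_mul, Matrix.mul_nonsing_inv _ hM, map_one,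
        one_apply_eq_self])

/-- The mean map has a local inverse at `θ`, with derivative the inverse Fisher information. -/
lemma exists_localInverse_mean [Nonempty Y] {φ : Y → EuclideanSpace ℝ (Fin d)}
    {θ : EuclideanSpace ℝ (Fin d)} (hI : IsUnit (fisherInfo φ θ).det) :
    ∃ g : EuclideanSpace ℝ (Fin d) → EuclideanSpace ℝ (Fin d),
      g (mean (expFamily φ θ) φ) = θ ∧
      (∀ᶠ μ in 𝓝 (mean (expFamily φ θ) φ), mean (expFamily φ (g μ)) φ = μ) ∧
      HasFDerivAt g ((matrixCLE (fisherInfo φ θ) hI).symm :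
          EuclideanSpace ℝ (Fin d) →L[ℝ] EuclideanSpace ℝ (Fin d))
        (mean (expFamily φ θ) φ) := by
  have h : HasStrictFDerivAt (fun θ => mean (expFamily φ θ) φ)
      (matrixCLE (fisherInfo φ θ) hI : EuclideanSpace ℝ (Fin d) →L[ℝ] EuclideanSpace ℝ (Fin d)) θ :=
    hasStrictFDerivAt_mean_expFamily φ θ
  exact ⟨h.localInverse _ _ _, h.localInverse_apply_image, h.eventually_right_inverse,
    h.to_localInverse.hasFDerivAt⟩

end ExponentialFamily

/-- **Multivariate central limit theorem** for square-integrable i.i.d. random vectors. -/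
theorem tendstoInDistribution_inv_sqrt_smul_sum_sub {d : ℕ} {Ω : Type*} [MeasurableSpace Ω]
    {P : Measure Ω} [IsProbabilityMeasure P] {X : ℕ → Ω → EuclideanSpace ℝ (Fin d)}
    (hX : MemLp (X 0) 2 P) (hindep : iIndepFun X P)
    (hident : ∀ i, IdentDistrib (X i) (X 0) P P)
    {S : Matrix (Fin d) (Fin d) ℝ} (hS : S.PosSemidef)
    (hvar : ∀ t : EuclideanSpace ℝ (Fin d),
      Var[fun ω => inner ℝ (X 0 ω) t; P] = (t : Fin d → ℝ) ⬝ᵥ S.mulVec t) :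
    TendstoInDistribution
      (fun (n : ℕ) ω => (√(n : ℝ))⁻¹ • (∑ k ∈ Finset.range n, X k ω - (n : ℝ) • ∫ ω, X 0 ω ∂P))
      atTop (id : EuclideanSpace ℝ (Fin d) → EuclideanSpace ℝ (Fin d)) (fun _ => P)
      (multivariateGaussian 0 S) where
  forall_aemeasurable n := by
    have := fun i => (hident i).aemeasurable_fst
    fun_prop
  tendsto := by
    have hm : ∀ i, AEMeasurable (X i) P := fun i => (hident i).aemeasurable_fst
    -- Cramér–Wold: the characteristic function of the vector at `t` is that of its projection on
    -- `t` at `1`, so the scalar theorem applies.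
    refine ProbabilityMeasure.tendsto_iff_tendsto_charFun.2 fun t => ?_
    have hmt : Measurable fun x : EuclideanSpace ℝ (Fin d) => inner ℝ x t := by fun_prop
    have key := tendstoInDistribution_inv_sqrt_mul_sum_sub (P := P)
      (X := fun i ω => inner ℝ (X i ω) t)
      (Y := id) (P' := gaussianReal 0 Var[fun ω => inner ℝ (X 0 ω) t; P].toNNReal)
      (HasLaw.id) (hX.inner_const t)
      (hindep.comp (fun _ x => inner ℝ x t) fun _ => hmt)
      (fun i => (hident i).comp hmt)
    have h1 := ProbabilityMeasure.tendsto_iff_tendsto_charFun.1 key.tendsto 1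
    simp only [ProbabilityMeasure.coe_mk, Measure.map_id, charFun_gaussianReal] at h1
    simp only [ProbabilityMeasure.coe_mk, Measure.map_id, charFun_multivariateGaussian hS]
    convert h1 using 2 with n
    · rw [charFun_apply, charFun_apply, integral_map (by fun_prop) (by fun_prop),
        integral_map (by fun_prop) (by fun_prop)]
      congr 1 with ω
      have h2 : ∫ ω, inner ℝ (X 0 ω) t ∂P = inner ℝ (∫ ω, X 0 ω ∂P) t := by
        simp_rw [real_inner_comm t]
        exact integral_inner (hX.integrable (by norm_num)) t
      simp [h2, inner_sub_left, inner_smul_left, sum_inner]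
    -- Positive semidefiniteness of `S` makes the truncation `toNNReal` harmless.
    · rw [hvar, Real.coe_toNNReal _ (by simpa using hS.dotProduct_mulVec_nonneg (t : Fin d → ℝ))]
      simp

/-! ### Moments of `β(o)` and the sandwich form of the asymptotic covariance -/

section Covariance

variable {Y : Type*} [Fintype Y] {d : ℕ}

lemma mean_apply (p : Y → ℝ) (f : Y → EuclideanSpace ℝ (Fin d)) (i : Fin d) :
    mean p f i = ∑ y, p y * f y i := by
  simp [mean]

/-- The centre `c` is arbitrary because `H` centres `φ(y)`, `y ∼ p_θ`, at the mean under `u`. -/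
lemma sum_smul_outerSq_sub_apply {p : Y → ℝ} (hp : ∑ y, p y = 1)
    (f : Y → EuclideanSpace ℝ (Fin d)) (c : EuclideanSpace ℝ (Fin d)) (i j : Fin d) :
    (∑ y, p y • outerSq (f y - c)) i j =
      ∑ y, p y * (f y i * f y j) - mean p f i * c j - c i * mean p f j + c i * c j := by
  have h : c i * c j = ∑ y, p y * (c i * c j) := by rw [← Finset.sum_mul, hp, one_mul]
  rw [h, mean_apply, mean_apply, Finset.sum_mul, Finset.mul_sum, ← Finset.sum_sub_distrib,
    ← Finset.sum_sub_distrib, ← Finset.sum_add_distrib, Matrix.sum_apply]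
  refine Finset.sum_congr rfl fun y _ => ?_
  simp [outerSq]
  ring

/-- The marginal law of an observation under randomized response. -/
noncomputable def obsLaw (φ : Y → EuclideanSpace ℝ (Fin d)) (ε : ℝ) (u : Y → ℝ)
    (θ : EuclideanSpace ℝ (Fin d)) (b : Y) : ℝ :=
  ε * expFamily φ θ b + (1 - ε) * u b

variable {φ : Y → EuclideanSpace ℝ (Fin d)} {ε : ℝ} {u : Y → ℝ} {θ : EuclideanSpace ℝ (Fin d)}

lemma sum_expFamily_mul_supervision [DecidableEq Y] [Nonempty Y] (b : Y) :
    ∑ a, expFamily φ θ a * supervision ε u b a = obsLaw φ ε u θ b := by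
  simp only [supervision, mul_add, Finset.sum_add_distrib, ← Finset.sum_mul, sum_expFamily,
    obsLaw, one_mul]
  simp [mul_comm]

lemma sum_obsLaw [Nonempty Y] (hu : ∑ y, u y = 1) : ∑ b, obsLaw φ ε u θ b = 1 := by
  simp [obsLaw, Finset.sum_add_distrib, ← Finset.mul_sum, sum_expFamily, hu]

lemma obsLaw_sum_mul (F : Y → ℝ) : ∑ b, obsLaw φ ε u θ b * F b =
    ε * ∑ b, expFamily φ θ b * F b + (1 - ε) * ∑ b, u b * F b := by
  simp_rw [Finset.mul_sum, ← Finset.sum_add_distrib, obsLaw]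
  exact Finset.sum_congr rfl fun b _ => by ring

lemma mean_obsLaw_apply (i : Fin d) : mean (obsLaw φ ε u θ) φ i =
    ε * mean (expFamily φ θ) φ i + (1 - ε) * mean u φ i := by
  rw [mean_apply, obsLaw_sum_mul, mean_apply, mean_apply]

lemma mean_obsFun [Nonempty Y] (hε : ε ≠ 0) (hu : ∑ y, u y = 1) :
    mean (obsLaw φ ε u θ) (obsFun φ ε u) = mean (expFamily φ θ) φ := by
  ext i
  have h : mean (obsLaw φ ε u θ) (obsFun φ ε u) i =
      ε⁻¹ * (mean (obsLaw φ ε u θ) φ i - (1 - ε) * mean u φ i) := by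
    have h1 : (1 - ε) * mean u φ i = ∑ b, obsLaw φ ε u θ b * ((1 - ε) * mean u φ i) := by
      rw [← Finset.sum_mul, sum_obsLaw hu, one_mul]
    rw [h1, mean_apply, mean_apply, ← Finset.sum_sub_distrib, Finset.mul_sum]
    refine Finset.sum_congr rfl fun b _ => ?_
    simp [obsFun]
    ring
  rw [h, mean_obsLaw_apply]
  field_simp
  ring

/-- The covariance of `β(o)` is the sum of the Fisher information and the information loss. -/
lemma covMat_obsFun [Nonempty Y] (hε : ε ≠ 0) (hu : ∑ y, u y = 1) :
    covMat (obsLaw φ ε u θ) (obsFun φ ε u) = fisherInfo φ θ + lossMat φ ε u θ := by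
  have h1 : ∀ b, obsFun φ ε u b - mean (obsLaw φ ε u θ) (obsFun φ ε u) =
      ε⁻¹ • (φ b - mean (obsLaw φ ε u θ) φ) := by
    intro b
    ext i
    rw [mean_obsFun hε hu]
    simp [obsFun, mean_obsLaw_apply]
    field_simp
    ring
  have h2 : covMat (obsLaw φ ε u θ) (obsFun φ ε u) =
      (ε⁻¹ ^ 2) • covMat (obsLaw φ ε u θ) φ := by
    simp_rw [covMat, h1, Finset.smul_sum]
    refine Finset.sum_congr rfl fun b _ => ?_
    ext i j
    simp [outerSq]
    ring
  rw [h2]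
  -- Raw moments under the mixture are linear in those under `p_θ` and `u`, so the entries become
  -- rational expressions that `ring` can compare.
  ext i j
  simp only [fisherInfo, lossMat, covMat, Matrix.add_apply, Matrix.smul_apply, smul_eq_mul,
    sum_smul_outerSq_sub_apply (sum_obsLaw hu), sum_smul_outerSq_sub_apply (sum_expFamily φ θ),
    sum_smul_outerSq_sub_apply hu, mean_obsLaw_apply, obsLaw_sum_mul]
  field_simp
  ring

lemma obsLaw_nonneg (hε0 : 0 < ε) (hε1 : ε ≤ 1) (hu : ∀ y, 0 ≤ u y) (b : Y) :
    0 ≤ obsLaw φ ε u θ b :=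
  add_nonneg (mul_nonneg hε0.le (expFamily_pos φ θ b).le) (mul_nonneg (sub_nonneg.2 hε1) (hu b))

lemma transpose_inv_fisherInfo : ((fisherInfo φ θ)⁻¹).transpose = (fisherInfo φ θ)⁻¹ := by
  have h : (fisherInfo φ θ).IsHermitian :=
    (posSemidef_sum_smul_outerSq (fun y => (expFamily_pos φ θ y).le) _).isHermitian
  have := h.inv
  rwa [Matrix.IsHermitian, Matrix.conjTranspose_eq_transpose_of_trivial] at this

/-- The sandwich form shows both positive semidefiniteness and that this is the covariance of `I⁻¹
β(o)`. -/
lemma asympVar_eq [Nonempty Y] (hI : IsUnit (fisherInfo φ θ).det) (hε : ε ≠ 0)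
    (hu : ∑ y, u y = 1) :
    asympVar φ ε u θ =
      (fisherInfo φ θ)⁻¹ * covMat (obsLaw φ ε u θ) (obsFun φ ε u) * (fisherInfo φ θ)⁻¹ := by
  rw [covMat_obsFun hε hu, asympVar, mul_add, add_mul, Matrix.nonsing_inv_mul _ hI, one_mul]

lemma posSemidef_asympVar [Nonempty Y] (hI : IsUnit (fisherInfo φ θ).det) (hε0 : 0 < ε)
    (hε1 : ε ≤ 1) (hu : u ∈ stdSimplex ℝ Y) : (asympVar φ ε u θ).PosSemidef := by
  rw [asympVar_eq hI hε0.ne' hu.2]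
  have := (posSemidef_sum_smul_outerSq (obsLaw_nonneg (φ := φ) (θ := θ) hε0 hε1 hu.1)
    (fun b => obsFun φ ε u b - mean (obsLaw φ ε u θ) (obsFun φ ε u))).mul_mul_conjTranspose_same
    (fisherInfo φ θ)⁻¹
  rwa [Matrix.conjTranspose_eq_transpose_of_trivial, transpose_inv_fisherInfo] at this

/-- The quadratic form of the asymptotic covariance is the variance of `⟪t, I⁻¹ β(o)⟫`. -/
lemma dotProduct_asympVar [Nonempty Y] (hI : IsUnit (fisherInfo φ θ).det) (hε : ε ≠ 0)
    (hu : ∑ y, u y = 1) (t : EuclideanSpace ℝ (Fin d)) :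
    (t : Fin d → ℝ) ⬝ᵥ (asympVar φ ε u θ).mulVec t =
      ∑ b, obsLaw φ ε u θ b * (inner ℝ ((matrixCLE (fisherInfo φ θ) hI).symm
        (obsFun φ ε u b - mean (obsLaw φ ε u θ) (obsFun φ ε u))) t) ^ 2 := by
  have hadj : ∀ v, inner ℝ ((matrixCLE (fisherInfo φ θ) hI).symm v) t =
      inner ℝ v (Matrix.toEuclideanCLM (𝕜 := ℝ) (fisherInfo φ θ)⁻¹ t) := by
    intro v
    change inner ℝ (Matrix.toEuclideanCLM (𝕜 := ℝ) (fisherInfo φ θ)⁻¹ v) t = _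
    rw [real_inner_comm, Matrix.inner_toEuclideanCLM, Matrix.inner_toEuclideanCLM,
      Matrix.dotProduct_mulVec, ← Matrix.mulVec_transpose, transpose_inv_fisherInfo]
    simp [dotProduct_comm]
  simp_rw [hadj]
  rw [← dotProduct_sum_smul_outerSq, asympVar_eq hI hε hu, Matrix.ofLp_toEuclideanCLM,
    ← covMat, ← Matrix.mulVec_mulVec, ← Matrix.mulVec_mulVec, Matrix.dotProduct_mulVec,
    ← Matrix.mulVec_transpose, transpose_inv_fisherInfo]

end Covariance

lemma muHat_eq_sum_range {Y : Type*} [Fintype Y] {d : ℕ} {φ : Y → EuclideanSpace ℝ (Fin d)}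
    {ε : ℝ} {u : Y → ℝ} (o : ℕ → Y) (n : ℕ) :
    muHat φ ε u (fun i : Fin n => o i) =
      (n : ℝ)⁻¹ • ∑ i ∈ Finset.range n, obsFun φ ε u (o i) := by
  rw [muHat, Fin.sum_univ_eq_sum_range (fun i => obsFun φ ε u (o i))]

/-! ### From the joint law of the sample to finite sums -/

section Sampling

variable {Y : Type*} [Fintype Y] [MeasurableSpace Y] [MeasurableSingletonClass Y]
  {d : ℕ} {φ : Y → EuclideanSpace ℝ (Fin d)} {ε : ℝ} {u : Y → ℝ} {θ : EuclideanSpace ℝ (Fin d)}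
  {Ω : Type*} [MeasurableSpace Ω] {P : Measure Ω}

lemma measureReal_obs_eq [DecidableEq Y] [Nonempty Y] [IsProbabilityMeasure P] {y o : Ω → Y}
    (hy : Measurable y) (ho : Measurable o)
    (hlaw : ∀ a b, P.real {ω | y ω = a ∧ o ω = b} = expFamily φ θ a * supervision ε u b a)
    (b : Y) : P.real {ω | o ω = b} = obsLaw φ ε u θ b := by
  have h : {ω | o ω = b} = ⋃ a ∈ (Finset.univ : Finset Y), {ω | y ω = a ∧ o ω = b} := by
    ext ω
    simp
  rw [h, measureReal_biUnion_finset]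
  · simp_rw [hlaw, sum_expFamily_mul_supervision]
  · intro a _ a' _ haa'
    refine Set.disjoint_left.2 fun ω h1 h2 => haa' (h1.1.symm.trans h2.1)
  · exact fun a _ => (hy (measurableSet_singleton a)).inter (ho (measurableSet_singleton b))

lemma integral_comp_eq_sum [IsProbabilityMeasure P] {E : Type*} [NormedAddCommGroup E]
    [NormedSpace ℝ E] [CompleteSpace E] {o : Ω → Y} (ho : Measurable o) {q : Y → ℝ}
    (hq : ∀ b, P.real {ω | o ω = b} = q b) (F : Y → E) :
    ∫ ω, F (o ω) ∂P = ∑ b, q b • F b := by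
  have : IsProbabilityMeasure (P.map o) := Measure.isProbabilityMeasure_map ho.aemeasurable
  rw [← integral_map ho.aemeasurable (f := F) (StronglyMeasurable.of_discrete).aestronglyMeasurable,
    integral_fintype (.of_finite)]
  refine Finset.sum_congr rfl fun b _ => ?_
  rw [map_measureReal_apply ho (measurableSet_singleton b), ← hq b]
  rfl

lemma identDistrib_of_measureReal_eq [IsProbabilityMeasure P] {o o' : Ω → Y} (ho : Measurable o)
    (ho' : Measurable o') (h : ∀ b, P.real {ω | o ω = b} = P.real {ω | o' ω = b}) :
    IdentDistrib o o' P P where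
  aemeasurable_fst := ho.aemeasurable
  aemeasurable_snd := ho'.aemeasurable
  map_eq := by
    refine Measure.ext_of_singleton fun b => ?_
    rw [Measure.map_apply ho (measurableSet_singleton b),
      Measure.map_apply ho' (measurableSet_singleton b)]
    exact (measureReal_eq_measureReal_iff).1 (h b)

end Sampling

/-- The **delta method** for estimators that eventually almost surely agree with a differentiable
function `g` of strongly consistent statistics `M n`. -/
theorem tendstoInDistribution_of_eventually_eq_comp {d : ℕ} {Ω : Type*} [MeasurableSpace Ω]
    {P : Measure Ω} [IsProbabilityMeasure P] {M S : ℕ → Ω → EuclideanSpace ℝ (Fin d)}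
    {μ : EuclideanSpace ℝ (Fin d)} {g : EuclideanSpace ℝ (Fin d) → EuclideanSpace ℝ (Fin d)}
    {A : EuclideanSpace ℝ (Fin d) ≃L[ℝ] EuclideanSpace ℝ (Fin d)}
    (hg : HasFDerivAt g (A : EuclideanSpace ℝ (Fin d) →L[ℝ] EuclideanSpace ℝ (Fin d)) μ)
    {ν : Measure (EuclideanSpace ℝ (Fin d))} [IsProbabilityMeasure ν]
    (hM : ∀ᵐ ω ∂P, Tendsto (fun n => M n ω) atTop (𝓝 μ))
    (hgM : ∀ n, AEMeasurable (fun ω => g (M n ω)) P) (hMm : ∀ n, AEMeasurable (M n) P)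
    (hS : ∀ n, AEMeasurable (S n) P)
    (hSM : ∀ᵐ ω ∂P, ∀ᶠ n in atTop, S n ω = g (M n ω))
    (hclt : TendstoInDistribution (fun (n : ℕ) ω => √(n : ℝ) • A (M n ω - μ)) atTop
      (id : EuclideanSpace ℝ (Fin d) → EuclideanSpace ℝ (Fin d)) (fun _ => P) ν) :
    TendstoInDistribution (fun (n : ℕ) ω => √(n : ℝ) • (S n ω - g μ)) atTop
      (id : EuclideanSpace ℝ (Fin d) → EuclideanSpace ℝ (Fin d)) (fun _ => P) ν := by
  -- `R` is the first-order Taylor remainder divided by `‖M n ω - μ‖`; where `M n ω = μ` the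
  -- convention `0⁻¹ = 0` makes it `0`.
  set R : ℕ → Ω → EuclideanSpace ℝ (Fin d) := fun n ω =>
    ‖M n ω - μ‖⁻¹ • (g (M n ω) - g μ - A (M n ω - μ)) with hR
  have hRm : ∀ n, AEMeasurable (R n) P := fun n => by
    have h1 := hgM n
    have h2 := hMm n
    have h3 : AEMeasurable (fun ω => A (M n ω - μ)) P :=
      A.continuous.measurable.comp_aemeasurable (h2.sub_const μ)
    exact (h2.sub_const μ).norm.inv.smul ((h1.sub_const _).sub h3)
  have hRlim : ∀ᵐ ω ∂P, Tendsto (fun n => R n ω) atTop (𝓝 0) := by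
    filter_upwards [hM] with ω hω
    have h1 := (hasFDerivAt_iff_tendsto.1 hg).comp hω
    refine tendsto_zero_iff_norm_tendsto_zero.2 (h1.congr fun n => ?_)
    simp [hR, norm_smul]
  have hRprob : TendstoInMeasure P R atTop fun _ => 0 :=
    tendstoInMeasure_of_tendsto_ae (fun n => (hRm n).aestronglyMeasurable) hRlim
  -- Slutsky: the rescaled remainder is `‖√n (M n - μ)‖ • R n`. Invertibility of `A` expresses this
  -- norm as a continuous function of the variable known to converge in distribution.
  have hslutsky := hclt.continuous_comp_prodMk_of_tendstoInMeasure_const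
    (g := fun p : EuclideanSpace ℝ (Fin d) × EuclideanSpace ℝ (Fin d) =>
      p.1 + ‖A.symm p.1‖ • p.2) (by fun_prop) hRprob hRm
  have hrepr : ∀ (n : ℕ) ω, √(n : ℝ) • A (M n ω - μ) + ‖A.symm (√(n : ℝ) • A (M n ω - μ))‖ • R n ω =
      √(n : ℝ) • (g (M n ω) - g μ) := by
    intro n ω
    rw [map_smul, A.symm_apply_apply, norm_smul, Real.norm_of_nonneg (Real.sqrt_nonneg _),
      mul_smul, ← smul_add]
    congr 1
    by_cases h0 : M n ω - μ = 0
    · rw [h0, sub_eq_zero.1 h0]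
      simp
    · rw [hR, smul_inv_smul₀ (norm_ne_zero_iff.2 h0)]
      abel
  simp only [hrepr, smul_zero, add_zero] at hslutsky
  refine tendstoInDistribution_of_tendstoInMeasure_sub _ _ hslutsky ?_ fun n =>
    ((hS n).sub_const (g μ)).const_smul √(n : ℝ)
  refine tendstoInMeasure_of_tendsto_ae (fun n => ?_) ?_
  · exact ((((hS n).sub_const (g μ)).const_smul √(n : ℝ)).sub
      (((hgM n).sub_const (g μ)).const_smul √(n : ℝ))).aestronglyMeasurable
  · filter_upwards [hSM] with ω hω
    refine tendsto_const_nhds.congr' ?_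
    filter_upwards [hω] with n hn
    simp [hn]

/-- Almost sure convergence gives convergence in probability. Only a lower bound on `P.real (B n)`
is needed, so `B n` need not be measurable. -/
lemma tendsto_measureReal_of_ae_tendsto {E Ω : Type*} [PseudoMetricSpace E] [MeasurableSpace E]
    [BorelSpace E] [SecondCountableTopology E]
    [MeasurableSpace Ω] {P : Measure Ω} [IsProbabilityMeasure P] {M : ℕ → Ω → E} {μ : E}
    (hM : ∀ᵐ ω ∂P, Tendsto (fun n => M n ω) atTop (𝓝 μ)) (hMm : ∀ n, Measurable (M n))
    {s : Set E} (hs : s ∈ 𝓝 μ) {B : ℕ → Set Ω} (hB : ∀ n, M n ⁻¹' s ⊆ B n) :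
    Tendsto (fun n => P.real (B n)) atTop (𝓝 1) := by
  obtain ⟨r, hr, hrs⟩ := Metric.mem_nhds_iff.1 hs
  have h1 : TendstoInMeasure P M atTop fun _ => μ :=
    tendstoInMeasure_of_tendsto_ae (fun n => (hMm n).aestronglyMeasurable) hM
  have h2 := tendstoInMeasure_iff_measureReal_dist.1 h1 r hr
  have h3 : Tendsto (fun n => 1 - P.real {ω | r ≤ dist (M n ω) μ}) atTop (𝓝 1) := by
    simpa using h2.const_sub 1
  refine tendsto_of_tendsto_of_tendsto_of_le_of_le h3 tendsto_const_nhds (fun n => ?_)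
    fun n => measureReal_le_one
  have hmeas : MeasurableSet {ω | r ≤ dist (M n ω) μ} :=
    measurableSet_le measurable_const ((hMm n).dist measurable_const)
  change 1 - P.real {ω | r ≤ dist (M n ω) μ} ≤ P.real (B n)
  rw [← probReal_compl_eq_one_sub hmeas]
  refine measureReal_mono fun ω hω => hB n (hrs ?_)
  simpa using hω

end RandResponse

/-! ### Asymptotic normality of the moments-based estimator -/

theorem lemma1 {Y : Type*} [Fintype Y] [DecidableEq Y] [MeasurableSpace Y]
    [MeasurableSingletonClass Y] {d : ℕ}
    (φ : Y → EuclideanSpace ℝ (Fin d)) (θ₀ : EuclideanSpace ℝ (Fin d))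
    (hI : IsUnit (RandResponse.fisherInfo φ θ₀).det)
    (u : Y → ℝ) (hu : u ∈ stdSimplex ℝ Y)
    (ε : ℝ) (hε0 : 0 < ε) (hε1 : ε ≤ 1)
    {Ω : Type*} [MeasurableSpace Ω] (P : Measure Ω) [IsProbabilityMeasure P]
    (y o : ℕ → Ω → Y) (hy : ∀ i, Measurable (y i)) (ho : ∀ i, Measurable (o i))
    (hindep : iIndepFun (fun i ω => (y i ω, o i ω)) P)
    (hlaw : ∀ i a b, P.real {ω | y i ω = a ∧ o i ω = b} =
      RandResponse.expFamily φ θ₀ a * RandResponse.supervision ε u b a)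
    (T : (n : ℕ) → (Fin n → Y) → EuclideanSpace ℝ (Fin d))
    (hT : ∀ n, RandResponse.IsMomentEstimator φ ε u n (T n)) :
    (RandResponse.asympVar φ ε u θ₀).PosSemidef ∧
    Tendsto (fun n : ℕ => P.real {ω | ∃! θ, RandResponse.IsMomentMaximizer φ
      (RandResponse.muHat φ ε u (fun i : Fin n => o i ω)) θ}) atTop (𝓝 1) ∧
    TendstoInDistribution
      (fun (n : ℕ) ω => √(n : ℝ) • (T n (fun i => o i ω) - θ₀)) atTop
      (id : EuclideanSpace ℝ (Fin d) → EuclideanSpace ℝ (Fin d)) (fun _ => P)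
      (multivariateGaussian 0 (RandResponse.asympVar φ ε u θ₀)) := by
  open RandResponse in
  have hYne : Nonempty Y := by
    by_contra h
    rw [not_nonempty_iff] at h
    simpa using hu.2
  set μ₀ := mean (expFamily φ θ₀) φ with hμ₀
  set A := (matrixCLE (fisherInfo φ θ₀) hI).symm with hA
  obtain ⟨g, hg0, hginv, hgd⟩ := exists_localInverse_mean hI
  set M : ℕ → Ω → EuclideanSpace ℝ (Fin d) := fun n ω =>
    muHat φ ε u (fun i : Fin n => o i ω) with hM
  have hPSD : (asympVar φ ε u θ₀).PosSemidef := posSemidef_asympVar hI hε0 hε1 hu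
  have hq : ∀ i b, P.real {ω | o i ω = b} = obsLaw φ ε u θ₀ b := fun i =>
    measureReal_obs_eq (hy i) (ho i) (hlaw i)
  have hoindep : iIndepFun o P := hindep.comp (fun _ => Prod.snd) fun _ => measurable_snd
  have hoident : ∀ i, IdentDistrib (o i) (o 0) P P := fun i =>
    identDistrib_of_measureReal_eq (ho i) (ho 0) fun b => by rw [hq, hq]
  have hdisc : ∀ {E : Type} [MeasurableSpace E] (F : Y → E), Measurable F := fun F =>
    measurable_of_finite F
  have hmem : ∀ F : Y → EuclideanSpace ℝ (Fin d), MemLp (fun ω => F (o 0 ω)) 2 P := fun F =>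
    MemLp.of_bound ((hdisc F).comp (ho 0)).aestronglyMeasurable (∑ b, ‖F b‖) <| ae_of_all _ fun ω =>
      Finset.single_le_sum (f := fun b => ‖F b‖) (fun _ _ => norm_nonneg _)
        (Finset.mem_univ (o 0 ω))
  have hsample : ∀ n, Measurable fun ω => (fun i : Fin n => o i ω) := fun n =>
    measurable_pi_lambda _ fun i => ho i
  -- The sample space is finite, so the arbitrary estimator `T n` and `g ∘ muHat` are measurable,
  -- although nothing is known of `g` away from `μ₀`.
  have hsampleF : ∀ n (F : (Fin n → Y) → EuclideanSpace ℝ (Fin d)),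
      Measurable fun ω => F (fun i : Fin n => o i ω) := fun n F =>
    (measurable_of_finite F).comp (hsample n)
  have hMm : ∀ n, Measurable (M n) := fun n => hsampleF n (muHat φ ε u)
  have hMlim : ∀ᵐ ω ∂P, Tendsto (fun n => M n ω) atTop (𝓝 μ₀) := by
    have h := strong_law_ae (μ := P) (fun i ω => obsFun φ ε u (o i ω))
      ((hmem (obsFun φ ε u)).integrable (by norm_num))
      (fun i j hij => (hoindep.indepFun hij).comp (hdisc (obsFun φ ε u)) (hdisc (obsFun φ ε u)))
      (fun i => (hoident i).comp (hdisc (obsFun φ ε u)))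
    rw [integral_comp_eq_sum (ho 0) (hq 0), ← mean, mean_obsFun hε0.ne' hu.2] at h
    filter_upwards [h] with ω hω
    exact hω.congr fun n => (muHat_eq_sum_range (fun i => o i ω) n).symm
  have hcltM : TendstoInDistribution (fun (n : ℕ) ω => √(n : ℝ) • A (M n ω - μ₀)) atTop
      (id : EuclideanSpace ℝ (Fin d) → EuclideanSpace ℝ (Fin d)) (fun _ => P)
      (multivariateGaussian 0 (asympVar φ ε u θ₀)) := by
    have hint : ∫ ω, A (obsFun φ ε u (o 0 ω)) ∂P = A μ₀ := by
      rw [integral_comp_eq_sum (ho 0) (hq 0) (fun b => A (obsFun φ ε u b)), hμ₀,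
        ← mean_obsFun (φ := φ) (θ := θ₀) hε0.ne' hu.2, mean, map_sum]
      simp
    -- Applying the theorem to `I⁻¹ β(o)` instead of `β(o)` yields the covariance `V` directly.
    have h := tendstoInDistribution_inv_sqrt_smul_sum_sub (P := P)
      (X := fun i ω => A (obsFun φ ε u (o i ω))) (hmem fun b => A (obsFun φ ε u b))
      (hoindep.comp (fun _ b => A (obsFun φ ε u b)) fun _ => hdisc _)
      (fun i => (hoident i).comp (hdisc fun b => A (obsFun φ ε u b))) hPSD fun t => by
        have hmeas : AEMeasurable (fun ω => inner ℝ (A (obsFun φ ε u (o 0 ω))) t) P :=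
          ((hdisc fun b => inner ℝ (A (obsFun φ ε u b)) t).comp (ho 0)).aemeasurable
        rw [variance_eq_integral hmeas, dotProduct_asympVar hI hε0.ne' hu.2,
          integral_comp_eq_sum (ho 0) (hq 0) (fun b => inner ℝ (A (obsFun φ ε u b)) t),
          integral_comp_eq_sum (ho 0) (hq 0) (fun b => (inner ℝ (A (obsFun φ ε u b)) t - _) ^ 2)]
        refine Finset.sum_congr rfl fun b _ => ?_
        rw [map_sub, inner_sub_left, mean, map_sum, sum_inner]
        simp [inner_smul_left, hA]
    refine h.congr (fun n => ae_of_all _ fun ω => ?_) (ae_eq_refl _)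
    simp only [hint]
    rw [hM]
    simp only [muHat_eq_sum_range (fun i => o i ω)]
    rw [map_sub, map_smul, map_sum]
    -- At `n = 0` both sides are `0`; otherwise `√n` may be cancelled.
    rcases eq_or_ne n 0 with rfl | hn
    · simp
    have hn' : √(n : ℝ) ≠ 0 := by positivity
    rw [smul_sub, smul_sub, smul_smul, smul_smul]
    congr 2
    · rw [← Real.sq_sqrt (Nat.cast_nonneg n : (0 : ℝ) ≤ n), Real.sqrt_sq (Real.sqrt_nonneg _)]
      field_simp
    · nth_rw 2 [← Real.mul_self_sqrt (Nat.cast_nonneg n : (0 : ℝ) ≤ n)]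
      field_simp
  refine ⟨hPSD, ?_, ?_⟩
  · refine tendsto_measureReal_of_ae_tendsto hMlim hMm hginv fun n ω hω => ?_
    exact ⟨g (M n ω), isMomentMaximizer_of_mean_eq hω, fun θ hθ =>
      eq_of_isMomentMaximizer hI hω hθ⟩
  · have hgM : ∀ n, AEMeasurable (fun ω => g (M n ω)) P := fun n =>
      (hsampleF n fun s => g (muHat φ ε u s)).aemeasurable
    have h := tendstoInDistribution_of_eventually_eq_comp (S := fun n ω => T n fun i => o i ω)
      hgd hMlim hgM (fun n => (hMm n).aemeasurable) (fun n => (hsampleF n (T n)).aemeasurable)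
      (by
        filter_upwards [hMlim] with ω hω
        filter_upwards [hω.eventually hginv] with n hn
        exact eq_of_isMomentMaximizer hI hn (hT n _ ⟨_, isMomentMaximizer_of_mean_eq hn⟩))
      hcltM
    rwa [hg0] at h
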